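/- Let $d\ge 0$ be an integer and let $\gamma_1,\gamma_2:[0,1]\to\mathbb{R}^d$ be curves of class $C^2$ (up to the endpoints, with one-sided derivatives there). For $1<p<\infty$ define $$f_p:[0,1]^2\to\mathbb{R},\qquad f_p(t_1,t_2)=\sum_{i=1}^d\bigl|(\gamma_1)_i(t_1)-(\gamma_2)_i(t_2)\bigr|^p .$$ A point $(t_1,t_2)\in[0,1]^2$ is called a critical (or singular) point of $f_p$ if the derivative of $f_p$ at $(t_1,t_2)$ (one-sided on the boundary of the square) is zero. A critical value is the image under $f_p$ of a critical point, and $\mathcal{R}_p\subset\mathbb{R}$, the set of regular values, is the set of all real numbers that are not critical values. Then: 1. $\mathcal{R}_p$ is open in $\mathbb{R}$ for every $1<p<\infty$. 2. $\mathcal{R}_p$ is dense in $\mathbb{R}$ for every $2\le p<\infty$. 3. For every $1<p<2$ there is an open dense set $U\subset\mathbb{R}$ such that every critical point $(t_1,t_2)$ of $f_p$ with $f_p(t_1,t_2)\in U$ satisfies $(\gamma_1)_i(t_1)=(\gamma_2)_i(t_2)$ for some $1\le i\le d$. 4. If the set of all $(t_1,t_2)\in[0,1]^2$ such that $(\gamma_1)_i'(t_1)=(\gamma_2)_i'(t_2)=0$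 for all $1\le i\le d$ has two-dimensional Lebesgue measure zero, then $\mathcal{R}_p$ is dense in $\mathbb{R}$ for every $1<p<\infty$. -/

import Mathlib

open Set MeasureTheory

/-- The joint parameter space `[0,1]²` of two curves. -/
def unitSquare : Set (ℝ × ℝ) := Icc (0 : ℝ) 1 ×ˢ Icc (0 : ℝ) 1

/-- The function `(t₁, t₂) ↦ ∑ i, |(γ₁)ᵢ(t₁) - (γ₂)ᵢ(t₂)| ^ p`. It is only ever considered on
`unitSquare`. -/
noncomputable def distPow {d : ℕ} (p : ℝ) (γ₁ γ₂ : ℝ → Fin d → ℝ) (t : ℝ × ℝ) : ℝ :=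
  ∑ i, |γ₁ t.1 i - γ₂ t.2 i| ^ p

/-- The critical (singular) points of `distPow p γ₁ γ₂` on `[0,1]²`: the points of the closed
square at which the derivative relative to the square (so one-sided at its boundary) is zero. -/
def criticalPoints {d : ℕ} (p : ℝ) (γ₁ γ₂ : ℝ → Fin d → ℝ) : Set (ℝ × ℝ) :=
  {t | t ∈ unitSquare ∧
    HasFDerivWithinAt (distPow p γ₁ γ₂) (0 : ℝ × ℝ →L[ℝ] ℝ) unitSquare t}

/-- The regular values: the real numbers that are not the image of a critical point. -/
def regularValues {d : ℕ} (p : ℝ) (γ₁ γ₂ : ℝ → Fin d → ℝ) : Set ℝ :=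
  (distPow p γ₁ γ₂ '' criticalPoints p γ₁ γ₂)ᶜ

/-- The parameter pairs at which the derivatives of all the coordinates of both curves vanish
(one-sided derivatives at the ends of `[0,1]`). -/
def commonCriticalParameters {d : ℕ} (γ₁ γ₂ : ℝ → Fin d → ℝ) : Set (ℝ × ℝ) :=
  {t | t ∈ unitSquare ∧ ∀ i,
    derivWithin (fun s => γ₁ s i) (Icc 0 1) t.1 = 0 ∧
    derivWithin (fun s => γ₂ s i) (Icc 0 1) t.2 = 0}

open Filter Topology Metric
open scoped NNReal ENNReal

/-! The critical points form a compact set, so the critical values are closed. Density holds because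
the critical values are null for every `p > 1`. The function `f_p` may fail to be `C²` where
coordinates agree, so the critical points are sorted by the set `T` of coordinates that differ. On a
stratum `f_p` equals the sum over `T`, which is `C²` nearby and still critical there, since `|x| ^
p` has zero derivative at `0`. This reduces to Sard for `C²` functions on a planar rectangle
(`volume_image_critical_eq_zero`). Near critical points `f` varies quadratically, hence maps area to
length; the Hessian vanishes at almost all of them, so the constant can be made arbitrarily small
off a null set. -/

/-- A map which satisfies a quadratic Hölder estimate at small scales maps planar area to length. -/
theorem volume_image_le_of_dist_le_sq {f : ℝ × ℝ → ℝ} {s : Set (ℝ × ℝ)} {δ : ℝ} (hδ : 0 < δ)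
    {C : ℝ≥0} (h : ∀ x ∈ s, ∀ y ∈ s, dist x y < δ → dist (f x) (f y) ≤ C * dist x y ^ 2) :
    volume (f '' s) ≤ C * volume s := by
  let u : ℕ → ℝ × ℝ := TopologicalSpace.denseSeq (ℝ × ℝ)
  -- Radius `δ / 2` makes `h` apply to any two points of `s` in one piece; disjointness lets the
  -- areas add up.
  let D : ℕ → Set (ℝ × ℝ) := disjointed fun n => ball (u n) (δ / 2)
  have hDm : ∀ n, MeasurableSet (D n) := fun n =>
    MeasurableSet.disjointed (fun _ => measurableSet_ball) n
  have hDu : ⋃ n, D n = univ := by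
    rw [iUnion_disjointed, eq_univ_iff_forall]
    intro x
    obtain ⟨n, hn⟩ := (TopologicalSpace.denseRange_denseSeq (ℝ × ℝ)).exists_dist_lt x (half_pos hδ)
    exact mem_iUnion.2 ⟨n, hn⟩
  have hpiece : ∀ n, volume (f '' (D n ∩ s)) ≤ C * volume (D n ∩ s) := by
    intro n
    have hold : HolderOnWith C 2 f (D n ∩ s) := by
      intro x hx y hy
      have hx' : dist x (u n) < δ / 2 := disjointed_subset _ n hx.1
      have hy' : dist y (u n) < δ / 2 := disjointed_subset _ n hy.1
      have hxy : dist x y < δ := by linarith [dist_triangle_right x y (u n)]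
      have := h x hx.2 y hy.2 hxy
      rw [edist_dist, edist_dist]
      calc ENNReal.ofReal (dist (f x) (f y)) ≤ ENNReal.ofReal (C * dist x y ^ 2) :=
            ENNReal.ofReal_le_ofReal this
        _ = C * ENNReal.ofReal (dist x y) ^ ((2 : ℝ≥0) : ℝ) := by
            rw [ENNReal.ofReal_mul C.coe_nonneg, ENNReal.ofReal_coe_nnreal,
              ENNReal.ofReal_pow dist_nonneg]
            norm_num
    -- Hölder exponent 2 turns two-dimensional Hausdorff measure into one-dimensional; for the sup
    -- metric both are Lebesgue measure.
    have := hold.hausdorffMeasure_image_le (by norm_num) (zero_le_one (α := ℝ))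
    simpa [hausdorffMeasure_real, hausdorffMeasure_prod_real] using this
  calc volume (f '' s) = volume (⋃ n, f '' (D n ∩ s)) := by
        rw [← image_iUnion, ← iUnion_inter, hDu, univ_inter]
    _ ≤ ∑' n, volume (f '' (D n ∩ s)) := measure_iUnion_le _
    _ ≤ ∑' n, C * volume (D n ∩ s) := ENNReal.tsum_le_tsum hpiece
    -- Restricting the measure gives additivity over the measurable `D n` although `s` may not be
    -- measurable.
    _ = C * ∑' n, volume.restrict s (D n) := by
        rw [ENNReal.tsum_mul_left]
        simp_rw [Measure.restrict_apply (hDm _)]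
    _ = C * volume s := by
        rw [← measure_iUnion (disjoint_disjointed _) hDm, hDu, Measure.restrict_apply_univ]

/-- Near a critical point, a bound on the second derivative gives a quadratic estimate. -/
theorem Convex.norm_sub_le_sq_of_second_deriv_le {E : Type*} [NormedAddCommGroup E]
    [NormedSpace ℝ E] {s : Set E} (hs : Convex ℝ s) {f : E → ℝ} {g : E → E →L[ℝ] ℝ}
    {h : E → E →L[ℝ] E →L[ℝ] ℝ} (hf : ∀ x ∈ s, HasFDerivWithinAt f (g x) s x)
    (hg : ∀ x ∈ s, HasFDerivWithinAt g (h x) s x) {C : ℝ} (hC : 0 ≤ C) {x y : E} (hx : x ∈ s)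
    (hy : y ∈ s) (hgx : g x = 0) (hb : ∀ z ∈ s, dist z x ≤ dist y x → ‖h z‖ ≤ C) :
    dist (f y) (f x) ≤ C * dist y x ^ 2 := by
  let t := s ∩ closedBall x (dist y x)
  have ht : Convex ℝ t := hs.inter (convex_closedBall _ _)
  have hxt : x ∈ t := ⟨hx, mem_closedBall_self dist_nonneg⟩
  have hyt : y ∈ t := ⟨hy, mem_closedBall.2 le_rfl⟩
  have hgb : ∀ z ∈ t, ‖g z‖ ≤ C * dist y x := by
    intro z hz
    have := ht.norm_image_sub_le_of_norm_hasFDerivWithin_le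
      (fun w hw => (hg w hw.1).mono inter_subset_left) (fun w hw => hb w hw.1 hw.2) hxt hz
    rw [hgx, sub_zero, ← dist_eq_norm] at this
    exact this.trans (mul_le_mul_of_nonneg_left hz.2 hC)
  have := ht.norm_image_sub_le_of_norm_hasFDerivWithin_le
    (fun w hw => (hf w hw.1).mono inter_subset_left) hgb hxt hyt
  rw [← dist_eq_norm, ← dist_eq_norm] at this
  linarith [this]

/-- The second derivative vanishes at almost all critical points. -/
theorem ae_fderivWithin_eq_zero_of_eq_zero {s K : Set (ℝ × ℝ)} (hs : MeasurableSet s)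
    (hsK : s ⊆ K) {g : ℝ × ℝ → ℝ × ℝ →L[ℝ] ℝ} {h : ℝ × ℝ → ℝ × ℝ →L[ℝ] ℝ × ℝ →L[ℝ] ℝ}
    (hg : ∀ x ∈ K, HasFDerivWithinAt g (h x) K x) (h0 : ∀ x ∈ s, g x = 0) :
    volume {x | x ∈ s ∧ h x ≠ 0} = 0 := by
  -- The dual is identified with the plane because `norm_fderiv_sub_le` concerns self-maps.
  let L : (ℝ × ℝ →L[ℝ] ℝ) →L[ℝ] ℝ × ℝ :=
    (ContinuousLinearMap.apply ℝ ℝ ((1, 0) : ℝ × ℝ)).prod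
      (ContinuousLinearMap.apply ℝ ℝ ((0, 1) : ℝ × ℝ))
  have hL : ∀ φ, L φ = 0 → φ = 0 := by
    intro φ hφ
    have h1 : φ (1, 0) = 0 := congrArg Prod.fst hφ
    have h2 : φ (0, 1) = 0 := congrArg Prod.snd hφ
    ext <;> simp [h1, h2]
  -- As `g` vanishes on `s`, the zero map approximates it with error 0, which forces a zero
  -- derivative at density points.
  have happ : ApproximatesLinearOn (fun x => L (g x)) (0 : ℝ × ℝ →L[ℝ] ℝ × ℝ) s 0 := by
    intro x hx y hy
    simp [h0 x hx, h0 y hy]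
  have key := happ.norm_fderiv_sub_le volume hs (fun x => L.comp (h x)) fun x hx =>
    L.hasFDerivAt.comp_hasFDerivWithinAt x ((hg x (hsK hx)).mono hsK)
  rw [ae_restrict_iff' hs, ae_iff] at key
  refine measure_mono_null ?_ key
  rintro x ⟨hxs, hx⟩
  refine fun hle => hx ?_
  replace hle := hle hxs
  have hz : L.comp (h x) = 0 := by simpa using hle
  refine ContinuousLinearMap.ext fun v => ?_
  exact hL _ (DFunLike.congr_fun hz v)

/-- The Morse–Sard theorem for `C²` functions on a compact convex subset of the plane. -/
theorem volume_image_critical_eq_zero {K : Set (ℝ × ℝ)} (hK : IsCompact K) (hKc : Convex ℝ K)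
    (hKu : UniqueDiffOn ℝ K) {f : ℝ × ℝ → ℝ} (hf : ContDiffOn ℝ 2 f K) :
    volume (f '' {x | x ∈ K ∧ HasFDerivWithinAt f (0 : ℝ × ℝ →L[ℝ] ℝ) K x}) = 0 := by
  set A := {x | x ∈ K ∧ HasFDerivWithinAt f (0 : ℝ × ℝ →L[ℝ] ℝ) K x}
  let g := fderivWithin ℝ f K
  let h := fderivWithin ℝ g K
  have hg1 : ContDiffOn ℝ 1 g K := hf.fderivWithin hKu (by norm_num)
  have hfg : ∀ x ∈ K, HasFDerivWithinAt f (g x) K x := fun x hx =>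
    (hf.differentiableOn (by norm_num) x hx).hasFDerivWithinAt
  have hgh : ∀ x ∈ K, HasFDerivWithinAt g (h x) K x := fun x hx =>
    (hg1.differentiableOn (by norm_num) x hx).hasFDerivWithinAt
  have hhc : ContinuousOn h K := hg1.continuousOn_fderivWithin hKu (by norm_num)
  have hA0 : ∀ x ∈ A, g x = 0 := fun x hx => (hKu x hx.1).eq (hfg x hx.1) hx.2
  have hAeq : A = K ∩ g ⁻¹' {0} := by
    ext x
    refine ⟨fun hx => ⟨hx.1, hA0 x hx⟩, fun hx => ⟨hx.1, ?_⟩⟩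
    have := hfg x hx.1
    rwa [show g x = 0 from hx.2] at this
  have hAm : MeasurableSet A := by
    rw [hAeq]
    exact (hg1.continuousOn.preimage_isClosed_of_isClosed hK.isClosed
      isClosed_singleton).measurableSet
  have hAK : A ⊆ K := fun x hx => hx.1
  have hhn : ContinuousOn (fun x => ‖h x‖) K :=
    (continuous_norm (E := ℝ × ℝ →L[ℝ] ℝ × ℝ →L[ℝ] ℝ)).comp_continuousOn hhc
  obtain ⟨C, hC⟩ := hK.bddAbove_image hhn
  replace hC : ∀ x ∈ K, ‖h x‖ ≤ C := fun x hx => hC (mem_image_of_mem _ hx)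
  have hsplit : f '' A ⊆ f '' {x | x ∈ A ∧ h x ≠ 0} ∪ f '' {x | x ∈ A ∧ h x = 0} := by
    rintro _ ⟨x, hx, rfl⟩
    by_cases hh : h x = 0
    · exact Or.inr ⟨x, ⟨hx, hh⟩, rfl⟩
    · exact Or.inl ⟨x, ⟨hx, hh⟩, rfl⟩
  refine measure_mono_null hsplit (measure_union_null ?_ ?_)
  · have := volume_image_le_of_dist_le_sq (f := f) (s := {x | x ∈ A ∧ h x ≠ 0}) one_pos
      (C := C.toNNReal) fun y hy x hx _ =>
        hKc.norm_sub_le_sq_of_second_deriv_le hfg hgh (NNReal.coe_nonneg _) hx.1.1 hy.1.1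
          (hA0 x hx.1) fun z hz _ => (hC z hz).trans (Real.le_coe_toNNReal C)
    rw [ae_fderivWithin_eq_zero_of_eq_zero hAm hAK hgh hA0, mul_zero] at this
    exact nonpos_iff_eq_zero.1 this
  · have hfin : volume {x | x ∈ A ∧ h x = 0} ≠ ∞ :=
      ((measure_mono fun x hx => hx.1.1).trans_lt hK.measure_lt_top).ne
    have hle : ∀ ε : ℝ≥0, 0 < ε →
        volume (f '' {x | x ∈ A ∧ h x = 0}) ≤ ε * volume {x | x ∈ A ∧ h x = 0} := by
      intro ε hε
      have huc : UniformContinuousOn h K := hK.uniformContinuousOn_of_continuous hhc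
      obtain ⟨δ, hδ, hu⟩ :=
        (Metric.uniformContinuousOn_iff (β := ℝ × ℝ →L[ℝ] ℝ × ℝ →L[ℝ] ℝ)).1 huc ε hε
      refine volume_image_le_of_dist_le_sq hδ fun y hy x hx hyx =>
        hKc.norm_sub_le_sq_of_second_deriv_le hfg hgh ε.coe_nonneg hx.1.1 hy.1.1 (hA0 x hx.1)
          fun z hz hzx => ?_
      have := hu z hz x hx.1.1 (hzx.trans_lt hyx)
      rw [hx.2] at this
      exact (dist_zero_right (h z)).symm.trans_le this.le
    have ht : Tendsto (fun ε : ℝ≥0 => (ε : ℝ≥0∞) * volume {x | x ∈ A ∧ h x = 0}) (𝓝[>] 0)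
        (𝓝 0) := by
      have : Tendsto (fun ε : ℝ≥0 => (ε : ℝ≥0∞) * volume {x | x ∈ A ∧ h x = 0}) (𝓝 0)
          (𝓝 (((0 : ℝ≥0) : ℝ≥0∞) * volume {x | x ∈ A ∧ h x = 0})) :=
        ENNReal.Tendsto.mul_const (ENNReal.tendsto_coe.2 tendsto_id) (Or.inr hfin)
      simpa using this.mono_left nhdsWithin_le_nhds
    exact nonpos_iff_eq_zero.1 (ge_of_tendsto ht (eventually_mem_nhdsWithin.mono hle))

/-! ### The functions `f_p` on the square -/

theorem isCompact_unitSquare : IsCompact unitSquare := isCompact_Icc.prod isCompact_Icc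

theorem uniqueDiffOn_unitSquare : UniqueDiffOn ℝ unitSquare :=
  (uniqueDiffOn_Icc one_pos).prod (uniqueDiffOn_Icc one_pos)

section Curves

variable {d : ℕ} {γ₁ γ₂ : ℝ → Fin d → ℝ}

theorem contDiffOn_coordinate_sub (hγ₁ : ContDiffOn ℝ 2 γ₁ (Icc 0 1))
    (hγ₂ : ContDiffOn ℝ 2 γ₂ (Icc 0 1)) (i : Fin d) :
    ContDiffOn ℝ 2 (fun t : ℝ × ℝ => γ₁ t.1 i - γ₂ t.2 i) unitSquare :=
  (((contDiffOn_pi.1 hγ₁) i).comp contDiffOn_fst fun _ ht => ht.1).sub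
    (((contDiffOn_pi.1 hγ₂) i).comp contDiffOn_snd fun _ ht => ht.2)

theorem contDiffOn_distPow (hγ₁ : ContDiffOn ℝ 2 γ₁ (Icc 0 1))
    (hγ₂ : ContDiffOn ℝ 2 γ₂ (Icc 0 1)) {p : ℝ} (hp : 1 < p) :
    ContDiffOn ℝ 1 (distPow p γ₁ γ₂) unitSquare :=
  ContDiffOn.sum fun i _ => (contDiff_norm_rpow (E := ℝ) hp).comp_contDiffOn
    ((contDiffOn_coordinate_sub hγ₁ hγ₂ i).of_le (by norm_num))

theorem isCompact_criticalPoints (hγ₁ : ContDiffOn ℝ 2 γ₁ (Icc 0 1))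
    (hγ₂ : ContDiffOn ℝ 2 γ₂ (Icc 0 1)) {p : ℝ} (hp : 1 < p) :
    IsCompact (criticalPoints p γ₁ γ₂) := by
  have hf := contDiffOn_distPow hγ₁ hγ₂ hp
  have hd : ∀ t ∈ unitSquare, HasFDerivWithinAt (distPow p γ₁ γ₂)
      (fderivWithin ℝ (distPow p γ₁ γ₂) unitSquare t) unitSquare t := fun t ht =>
    (hf.differentiableOn (by norm_num) t ht).hasFDerivWithinAt
  have heq : criticalPoints p γ₁ γ₂ =
      unitSquare ∩ fderivWithin ℝ (distPow p γ₁ γ₂) unitSquare ⁻¹' {0} := by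
    ext t
    refine ⟨fun ht => ⟨ht.1, (uniqueDiffOn_unitSquare t ht.1).eq (hd t ht.1) ht.2⟩,
      fun ht => ⟨ht.1, ?_⟩⟩
    have := hd t ht.1
    rwa [mem_singleton_iff.1 ht.2] at this
  rw [heq]
  exact isCompact_unitSquare.of_isClosed_subset
    ((hf.continuousOn_fderivWithin uniqueDiffOn_unitSquare le_rfl).preimage_isClosed_of_isClosed
      isCompact_unitSquare.isClosed isClosed_singleton) inter_subset_left

theorem isOpen_regularValues (hγ₁ : ContDiffOn ℝ 2 γ₁ (Icc 0 1))
    (hγ₂ : ContDiffOn ℝ 2 γ₂ (Icc 0 1)) {p : ℝ} (hp : 1 < p) :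
    IsOpen (regularValues p γ₁ γ₂) :=
  ((isCompact_criticalPoints hγ₁ hγ₂ hp).image_of_continuousOn
    ((contDiffOn_distPow hγ₁ hγ₂ hp).continuousOn.mono fun _ ht => ht.1)).isClosed.isOpen_compl

/-! ### Strata of critical points by differing coordinates -/

open Classical in
/-- The set of coordinates in which the two curves differ. -/
noncomputable def differingCoordinates (γ₁ γ₂ : ℝ → Fin d → ℝ) (t : ℝ × ℝ) : Finset (Fin d) :=
  Finset.univ.filter fun i => γ₁ t.1 i ≠ γ₂ t.2 i

theorem mem_differingCoordinates {t : ℝ × ℝ} {i : Fin d} :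
    i ∈ differingCoordinates γ₁ γ₂ t ↔ γ₁ t.1 i ≠ γ₂ t.2 i := by
  simp [differingCoordinates]

theorem distPow_eq_sum_differingCoordinates {p : ℝ} (hp : 1 < p) (t : ℝ × ℝ) :
    distPow p γ₁ γ₂ t = ∑ i ∈ differingCoordinates γ₁ γ₂ t, |γ₁ t.1 i - γ₂ t.2 i| ^ p := by
  refine (Finset.sum_subset (Finset.subset_univ _) fun i _ hi => ?_).symm
  rw [mem_differingCoordinates, not_not] at hi
  rw [hi, sub_self, abs_zero, Real.zero_rpow (by linarith)]

/-- A critical point stays critical when the coordinates that agree there are dropped. -/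
theorem hasFDerivWithinAt_sum_differingCoordinates (hγ₁ : ContDiffOn ℝ 2 γ₁ (Icc 0 1))
    (hγ₂ : ContDiffOn ℝ 2 γ₂ (Icc 0 1)) {p : ℝ} (hp : 1 < p) {t : ℝ × ℝ}
    (ht : t ∈ criticalPoints p γ₁ γ₂) :
    HasFDerivWithinAt (fun s : ℝ × ℝ => ∑ i ∈ differingCoordinates γ₁ γ₂ t,
      |γ₁ s.1 i - γ₂ s.2 i| ^ p) (0 : ℝ × ℝ →L[ℝ] ℝ) unitSquare t := by
  classical
  have hrest : HasFDerivWithinAt (fun s : ℝ × ℝ => ∑ i ∈ (differingCoordinates γ₁ γ₂ t)ᶜ,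
      |γ₁ s.1 i - γ₂ s.2 i| ^ p) (∑ i ∈ (differingCoordinates γ₁ γ₂ t)ᶜ, (0 : ℝ × ℝ →L[ℝ] ℝ))
      unitSquare t := by
    refine HasFDerivWithinAt.fun_sum fun i hi => ?_
    rw [Finset.mem_compl, mem_differingCoordinates, not_not] at hi
    have hu := ((contDiffOn_coordinate_sub hγ₁ hγ₂ i).differentiableOn (by norm_num) t
      ht.1).hasFDerivWithinAt
    have habs := hasDerivAt_abs_rpow (γ₁ t.1 i - γ₂ t.2 i) hp
    have := habs.comp_hasFDerivWithinAt t hu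
    simp only [hi, sub_self, mul_zero, zero_smul] at this
    exact this
  have := ht.2.sub hrest
  rw [Finset.sum_const_zero, sub_zero] at this
  refine HasFDerivWithinAt.congr' this (fun s _ => ?_) ht.1
  simp only [distPow, Pi.sub_apply]
  rw [eq_sub_iff_add_eq, Finset.sum_add_sum_compl]

theorem contDiffOn_sum_abs_rpow (hγ₁ : ContDiffOn ℝ 2 γ₁ (Icc 0 1))
    (hγ₂ : ContDiffOn ℝ 2 γ₂ (Icc 0 1)) (p : ℝ) (T : Finset (Fin d)) {K : Set (ℝ × ℝ)}
    (hK : K ⊆ unitSquare) (hT : ∀ t ∈ K, ∀ i ∈ T, γ₁ t.1 i ≠ γ₂ t.2 i) :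
    ContDiffOn ℝ 2 (fun t : ℝ × ℝ => ∑ i ∈ T, |γ₁ t.1 i - γ₂ t.2 i| ^ p) K := by
  refine ContDiffOn.sum fun i hi t ht => ?_
  have hne : γ₁ t.1 i - γ₂ t.2 i ≠ 0 := sub_ne_zero.2 (hT t ht i hi)
  exact ((contDiffAt_abs hne).rpow_const_of_ne (abs_ne_zero.2 hne)).comp_contDiffWithinAt t
    ((contDiffOn_coordinate_sub hγ₁ hγ₂ i).mono hK t ht)

/-- Every point of the unit square has arbitrarily small rectangular neighbourhoods in it. -/
theorem exists_rectangle_mem_nhdsWithin_unitSquare {t : ℝ × ℝ} (ht : t ∈ unitSquare)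
    {V : Set (ℝ × ℝ)} (hV : V ∈ 𝓝[unitSquare] t) :
    ∃ K ⊆ V ∩ unitSquare, K ∈ 𝓝[unitSquare] t ∧ IsCompact K ∧ Convex ℝ K ∧ UniqueDiffOn ℝ K := by
  obtain ⟨r, hr, hrV⟩ := (nhdsWithin_hasBasis nhds_basis_closedBall unitSquare).mem_iff.1 hV
  have hlt : ∀ x ∈ Icc (0 : ℝ) 1, max 0 (x - r) < min 1 (x + r) := by
    intro x hx
    simp only [max_lt_iff, lt_min_iff]
    refine ⟨⟨one_pos, ?_⟩, ?_, ?_⟩ <;> linarith [hx.1, hx.2]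
  have heq : closedBall t r ∩ unitSquare =
      Icc (max 0 (t.1 - r)) (min 1 (t.1 + r)) ×ˢ Icc (max 0 (t.2 - r)) (min 1 (t.2 + r)) := by
    rw [← Prod.mk.eta (p := t), ← closedBall_prod_same, unitSquare, prod_inter_prod,
      Real.closedBall_eq_Icc, Real.closedBall_eq_Icc, Icc_inter_Icc, Icc_inter_Icc]
    simp only [max_comm, min_comm]
  refine ⟨closedBall t r ∩ unitSquare, fun x hx => ⟨hrV hx, hx.2⟩, ?_, ?_, ?_, ?_⟩
  · exact inter_mem (mem_nhdsWithin_of_mem_nhds (closedBall_mem_nhds t hr)) self_mem_nhdsWithin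
  · rw [heq]; exact isCompact_Icc.prod isCompact_Icc
  · rw [heq]; exact (convex_Icc _ _).prod (convex_Icc _ _)
  · rw [heq]; exact (uniqueDiffOn_Icc (hlt _ ht.1)).prod (uniqueDiffOn_Icc (hlt _ ht.2))

/-- The critical values form a null set, for every exponent `p > 1`. -/
theorem volume_image_criticalPoints_eq_zero (hγ₁ : ContDiffOn ℝ 2 γ₁ (Icc 0 1))
    (hγ₂ : ContDiffOn ℝ 2 γ₂ (Icc 0 1)) {p : ℝ} (hp : 1 < p) :
    volume (distPow p γ₁ γ₂ '' criticalPoints p γ₁ γ₂) = 0 := by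
  let P : Finset (Fin d) → Set (ℝ × ℝ) := fun T =>
    {t | t ∈ criticalPoints p γ₁ γ₂ ∧ differingCoordinates γ₁ γ₂ t = T}
  have hcover : distPow p γ₁ γ₂ '' criticalPoints p γ₁ γ₂ ⊆ ⋃ T, distPow p γ₁ γ₂ '' P T := by
    rintro _ ⟨t, ht, rfl⟩
    exact mem_iUnion.2 ⟨_, t, ⟨ht, rfl⟩, rfl⟩
  refine measure_mono_null hcover (measure_iUnion_null fun T => ?_)
  have hloc : ∀ t ∈ P T, ∃ K ∈ 𝓝[P T] t, volume (distPow p γ₁ γ₂ '' (K ∩ P T)) = 0 := by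
    rintro t ⟨ht, hT⟩
    have hV : {s | ∀ i ∈ T, γ₁ s.1 i ≠ γ₂ s.2 i} ∈ 𝓝[unitSquare] t := by
      change ∀ᶠ s in 𝓝[unitSquare] t, ∀ i ∈ T, γ₁ s.1 i ≠ γ₂ s.2 i
      rw [Finset.eventually_all]
      intro i hi
      have hne : γ₁ t.1 i - γ₂ t.2 i ≠ 0 :=
        sub_ne_zero.2 (mem_differingCoordinates.1 (hT ▸ hi))
      filter_upwards [((contDiffOn_coordinate_sub hγ₁ hγ₂ i).continuousOn t
        ht.1).eventually_ne hne] with s hs using sub_ne_zero.1 hs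
    obtain ⟨K, hKV, hKn, hKc, hKconv, hKu⟩ := exists_rectangle_mem_nhdsWithin_unitSquare ht.1 hV
    refine ⟨K, nhdsWithin_mono t (fun s hs => hs.1.1) hKn, ?_⟩
    refine measure_mono_null ?_ (volume_image_critical_eq_zero hKc hKconv hKu
      (contDiffOn_sum_abs_rpow hγ₁ hγ₂ p T (fun s hs => (hKV hs).2) fun s hs => (hKV hs).1))
    rintro _ ⟨s, ⟨hsK, hs, rfl⟩, rfl⟩
    refine ⟨s, ⟨hsK, ?_⟩, (distPow_eq_sum_differingCoordinates hp s).symm⟩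
    exact (hasFDerivWithinAt_sum_differingCoordinates hγ₁ hγ₂ hp hs).mono fun x hx => (hKV hx).2
  choose! K hK hnull using hloc
  obtain ⟨c, hcP, hcc, hc⟩ := TopologicalSpace.countable_cover_nhdsWithin hK
  refine measure_mono_null ?_ ((measure_biUnion_null_iff hcc).2 fun t ht => hnull t (hcP ht))
  rintro _ ⟨s, hs, rfl⟩
  obtain ⟨t, ht, hst⟩ := mem_iUnion₂.1 (hc hs)
  exact mem_iUnion₂.2 ⟨t, ht, s, ⟨hst, hs⟩, rfl⟩

theorem dense_regularValues (hγ₁ : ContDiffOn ℝ 2 γ₁ (Icc 0 1))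
    (hγ₂ : ContDiffOn ℝ 2 γ₂ (Icc 0 1)) {p : ℝ} (hp : 1 < p) :
    Dense (regularValues p γ₁ γ₂) :=
  Measure.dense_of_ae (measure_eq_zero_iff_ae_notMem.1
    (volume_image_criticalPoints_eq_zero hγ₁ hγ₂ hp))

end Curves

theorem proposition3p1 {d : ℕ} (γ₁ γ₂ : ℝ → Fin d → ℝ)
    (hγ₁ : ContDiffOn ℝ 2 γ₁ (Icc 0 1)) (hγ₂ : ContDiffOn ℝ 2 γ₂ (Icc 0 1)) :
    (∀ p : ℝ, 1 < p → IsOpen (regularValues p γ₁ γ₂)) ∧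
    (∀ p : ℝ, 2 ≤ p → Dense (regularValues p γ₁ γ₂)) ∧
    (∀ p : ℝ, 1 < p → p < 2 →
      ∃ U : Set ℝ, IsOpen U ∧ Dense U ∧
        ∀ t ∈ criticalPoints p γ₁ γ₂, distPow p γ₁ γ₂ t ∈ U →
          ∃ i : Fin d, γ₁ t.1 i = γ₂ t.2 i) ∧
    (volume (commonCriticalParameters γ₁ γ₂) = 0 →
      ∀ p : ℝ, 1 < p → Dense (regularValues p γ₁ γ₂)) :=
  ⟨fun _ hp => isOpen_regularValues hγ₁ hγ₂ hp,
    fun _ hp => dense_regularValues hγ₁ hγ₂ (by linarith),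
    -- No critical point has a regular value, so this choice of `U` makes the condition vacuous.
    fun p hp _ => ⟨regularValues p γ₁ γ₂, isOpen_regularValues hγ₁ hγ₂ hp,
      dense_regularValues hγ₁ hγ₂ hp, fun t ht hU => absurd (mem_image_of_mem _ ht) hU⟩,
    fun _ _ hp => dense_regularValues hγ₁ hγ₂ hp⟩
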